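/- Let $\mathbb K$ be a field of characteristic zero, let $n\ge 3$, and let $A_n$ be the $\mathbb K$-vector space with basis $x_1,\dots,x_n$. Let $T(A_n)=\bigoplus_{i\ge 0}A_n^{\otimes i}$ be the free associative unital algebra on $x_1,\dots,x_n$, graded by word length, with $T(A_n)(d)=A_n^{\otimes d}$ (zero for $d<0$). Let $\operatorname{Der}(T(A_n))$ be the Lie algebra of all $\mathbb K$-linear maps $D:T(A_n)\to T(A_n)$ with $D(ab)=D(a)b+aD(b)$, with bracket $[D_1,D_2]=D_1\circ D_2-D_2\circ D_1$; a derivation $D$ has degree $k\in\mathbb Z$ if $D(T(A_n)(m))\subseteq T(A_n)(m+k)$ for all $m$. Let $|T(A_n)|=T(A_n)/[T(A_n),T(A_n)]$ be the space of cyclic words, the quotient by the linear span of all commutators $ab-ba$, with the induced grading and the action $D\cdot|a|=|D(a)|$ of $\operatorname{Der}(T(A_n))$. A linear map $c:\operatorname{Der}(T(A_n))\to|T(A_n)|$ is a $1$-cocycle if $c([u,v])=u\cdot c(v)-v\cdot c(u)$ for all $u,v\in\operatorname{Der}(T(A_n))$, and it has degree zero if, for every $k$, it sends derivations of degree $k$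 to elements of degree $k$ of $|T(A_n)|$. Then there is no nonzero $1$-cocycle $c:\operatorname{Der}(T(A_n))\to|T(A_n)|$ of degree zero; that is, every such $c$ is identically zero. -/

import Mathlib

attribute [local instance 100] LieRing.ofAssociativeRing

namespace CyclicWords

/-- The free associative (unital) algebra `T(A_n)` on `x_1, …, x_n`, that is, the tensor algebra
`⨁_{i ≥ 0} A_n^{⊗ i}` of the vector space `A_n` with basis `x_1, …, x_n`. -/
abbrev T (K : Type*) [Field K] (n : ℕ) : Type _ := FreeAlgebra K (Fin n)

section

variable (K : Type*) [Field K] (n : ℕ)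

/-- The homogeneous component `T(A_n)(d) = A_n^{⊗ d}`: the span of the words of length `d`.
It is zero for `d < 0`. -/
def homogeneousPart (d : ℤ) : Submodule K (T K n) :=
  Submodule.span K
    {w | ∃ l : List (Fin n), (l.length : ℤ) = d ∧ w = (l.map (FreeAlgebra.ι K)).prod}

/-- `Der(T(A_n))`: the Lie algebra of all `K`-linear derivations of the associative algebra
`T(A_n)`, with bracket `[D₁, D₂] = D₁ ∘ D₂ - D₂ ∘ D₁` (inherited from `Module.End`). -/
def Der : LieSubalgebra K (Module.End K (T K n)) where
  carrier := {D | ∀ a b : T K n, D (a * b) = D a * b + a * D b}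
  add_mem' := by
    intro D E hD hE a b
    simp only [LinearMap.add_apply, hD a b, hE a b, add_mul, mul_add]
    abel
  zero_mem' := by
    intro a b
    simp
  smul_mem' := by
    intro r D hD a b
    simp only [LinearMap.smul_apply, hD a b, smul_add, smul_mul_assoc, mul_smul_comm]
  lie_mem' := by
    intro D E hD hE a b
    change D (E (a * b)) - E (D (a * b)) = (D (E a) - E (D a)) * b + a * (D (E b) - E (D b))
    rw [hE a b, hD a b, map_add, map_add, hD, hD, hE, hE, sub_mul, mul_sub]
    abel

/-- `Der(T(A_n))(k)`: the derivations `D` that are homogeneous of degree `k`, i.e.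
`D (T(A_n)(m)) ⊆ T(A_n)(m + k)` for all `m`. -/
def derPart (k : ℤ) : Submodule K (Der K n) where
  carrier := {D | ∀ m : ℤ, ∀ a ∈ homogeneousPart K n m, D.1 a ∈ homogeneousPart K n (m + k)}
  add_mem' := fun hD hE m a ha => Submodule.add_mem _ (hD m a ha) (hE m a ha)
  zero_mem' := fun _ _ _ => Submodule.zero_mem _
  smul_mem' := fun r _ hD m a ha => Submodule.smul_mem _ r (hD m a ha)

/-- The linear span `[T(A_n), T(A_n)]` of the commutators `a b - b a`. -/
def commutatorSpan : Submodule K (T K n) :=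
  Submodule.span K {x | ∃ a b : T K n, x = a * b - b * a}

/-- The space of cyclic words `|T(A_n)| = T(A_n) / [T(A_n), T(A_n)]`. -/
abbrev Cyc : Type _ := T K n ⧸ commutatorSpan K n

/-- `|T(A_n)|(d)`: the image of `T(A_n)(d)` in `|T(A_n)|`. -/
def cycPart (d : ℤ) : Submodule K (Cyc K n) :=
  (homogeneousPart K n d).map (commutatorSpan K n).mkQ

variable {K n}

theorem map_commutatorSpan (D : Der K n) :
    commutatorSpan K n ≤ (commutatorSpan K n).comap D.1 := by
  refine Submodule.span_le.2 ?_
  rintro _ ⟨a, b, rfl⟩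
  have h : D.1 (a * b - b * a) = (D.1 a * b - b * D.1 a) + (a * D.1 b - D.1 b * a) := by
    rw [map_sub, D.2 a b, D.2 b a]
    abel
  change D.1 (a * b - b * a) ∈ commutatorSpan K n
  rw [h]
  exact Submodule.add_mem _ (Submodule.subset_span ⟨_, _, rfl⟩) (Submodule.subset_span ⟨_, _, rfl⟩)

/-- The action of a derivation on cyclic words, `D · |a| = |D a|`. -/
def onCyc (D : Der K n) : Cyc K n →ₗ[K] Cyc K n :=
  (commutatorSpan K n).mapQ (commutatorSpan K n) D.1 (map_commutatorSpan D)

theorem onCyc_mk (D : Der K n) (a : T K n) :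
    onCyc D ((commutatorSpan K n).mkQ a) = (commutatorSpan K n).mkQ (D.1 a) := rfl

instance : LieRingModule (Der K n) (Cyc K n) where
  bracket D x := onCyc D x
  add_lie D E x := by
    obtain ⟨a, rfl⟩ := (commutatorSpan K n).mkQ_surjective x
    simp only [onCyc_mk, ← map_add]
    rfl
  lie_add D x y := map_add (onCyc D) x y
  leibniz_lie D E x := by
    obtain ⟨a, rfl⟩ := (commutatorSpan K n).mkQ_surjective x
    simp only [onCyc_mk, ← map_add]
    congr 1
    change D.1 (E.1 a) = (D.1 (E.1 a) - E.1 (D.1 a)) + E.1 (D.1 a)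
    abel

instance : LieModule K (Der K n) (Cyc K n) where
  smul_lie r D x := by
    obtain ⟨a, rfl⟩ := (commutatorSpan K n).mkQ_surjective x
    rfl
  lie_smul r D x := map_smul (onCyc D) r x

/-- A linear map `c : Der(T(A_n)) → |T(A_n)|` has degree zero if it sends derivations of degree `k`
to cyclic words of degree `k`, for every `k`. -/
def IsDegreeZero (c : Der K n →ₗ[K] Cyc K n) : Prop :=
  ∀ k : ℤ, ∀ D ∈ derPart K n k, c D ∈ cycPart K n k

end

/-- A linear map `c : 𝔤 → M` from a Lie algebra to a Lie module is a 1-cocycle if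
`c([u, v]) = u · c(v) - v · c(u)`. -/
def IsOneCocycle {K 𝔤 M : Type*} [CommRing K] [LieRing 𝔤] [LieAlgebra K 𝔤] [AddCommGroup M]
    [Module K M] [LieRingModule 𝔤 M] (c : 𝔤 →ₗ[K] M) : Prop :=
  ∀ u v : 𝔤, c ⁅u, v⁆ = ⁅u, c v⁆ - ⁅v, c u⁆

end CyclicWords

/-!
Fix a letter `x_l`. The Euler derivation `x_l ∂_l` has degree zero, so a degree zero cocycle `c`
maps it to a multiple of `|1|`, which every derivation kills; hence `c` preserves the weight in
`x_l`, the eigenvalue of `x_l ∂_l`. Cyclic words have weights in `ℕ`, so `c` vanishes on derivations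
of weight `-1`, in particular on `z ∂_l` whenever `z` does not contain `x_l`.

The weight of an arbitrary derivation is lowered to zero by such derivations. If `v` has weight
`r ≥ 1`, then `c [z ∂_l, v] = z ∂_l · c(v)`, and `[z ∂_l, v]` has weight `r - 1`. The action on cyclic
words has the form `z ∂_l |a| = |z η|` with a cyclic derivative `η` of `a`
(`exists_cyclicDerivative`). As `z` may be arbitrarily long, already the words `z = x^N y` in two
letters other than `x_l` detect `η` (`eq_zero_of_forall_cyc`), and `r |a| = |x_l η|`. So `c(v)` is
zero if `c` vanishes in weight `r - 1` (`cocycle_eq_zero_of_weight`).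

In weight zero there are the derivations `(α x_l β) ∂_l` and `z ∂_i`, `i ≠ l`, where `α`, `β`, `z` do
not contain `x_l`. On the former, `c` is equivariant under the derivations of the subalgebra without
`x_l`, and this forces `c ((α x_l β) ∂_l) = κ |α β|` for a scalar `κ` (`exists_cocycle_insDer`). The
value on the latter follows from the brackets of `z ∂_l` with `(x_l q) ∂_i`, both of which `c` kills
(`cocycle_der_mul`). Evaluating `c ((x y x x y) ∂_x)` in this way, for `q = 1` and for `q = y`, gives
`κ |x x y y| + 2 κ |x y x y| = 2 κ |x x y y| + κ |x y x y|`, whence `κ = 0` (`cocycle_insDer`).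
-/

namespace CyclicWords

variable {K : Type*} [Field K] {n : ℕ}

/-! ### Words -/

/-- The generator `x_i`. -/
abbrev X (K : Type*) [Field K] {n : ℕ} (i : Fin n) : T K n := FreeAlgebra.ι K i

/-- The word `x_{i_1} ⋯ x_{i_r}` attached to the list `[i_1, …, i_r]`. -/
def word (K : Type*) [Field K] {n : ℕ} (L : List (Fin n)) : T K n :=
  (L.map (FreeAlgebra.ι K)).prod

@[simp] theorem word_nil : word K ([] : List (Fin n)) = 1 := rfl

theorem word_cons (i : Fin n) (L : List (Fin n)) : word K (i :: L) = X K i * word K L := by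
  simp [word]

theorem word_append (L M : List (Fin n)) : word K (L ++ M) = word K L * word K M := by
  simp [word]

/-- The words, as a basis of `T(A_n)`. -/
noncomputable def wordBasis (K : Type*) [Field K] (n : ℕ) : Module.Basis (List (Fin n)) K (T K n) :=
  FreeAlgebra.basisFreeMonoid K (Fin n)

theorem wordBasis_apply (L : List (Fin n)) : wordBasis K n L = word K L := by
  have h : wordBasis K n L = FreeAlgebra.equivMonoidAlgebraFreeMonoid.symm
      (MonoidAlgebra.of K (FreeMonoid (Fin n)) (FreeMonoid.ofList L)) := rfl
  rw [h, FreeAlgebra.equivMonoidAlgebraFreeMonoid]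
  simp [word, FreeMonoid.lift_apply]

theorem span_word : Submodule.span K (Set.range (word K (n := n))) = ⊤ := by
  rw [← (wordBasis K n).span_eq]
  congr 1
  ext x
  simp [wordBasis_apply]

theorem linearMap_ext_word {M : Type*} [AddCommGroup M] [Module K M] {f g : T K n →ₗ[K] M}
    (h : ∀ L, f (word K L) = g (word K L)) : f = g :=
  (wordBasis K n).ext fun L => by simpa only [wordBasis_apply] using h L

/-! ### Derivations -/

theorem lie_apply (D E : Der K n) (a : T K n) :
    (⁅D, E⁆ : Der K n).1 a = D.1 (E.1 a) - E.1 (D.1 a) := rfl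

theorem der_map_mul (D : Der K n) (a b : T K n) : D.1 (a * b) = D.1 a * b + a * D.1 b :=
  D.2 a b

theorem der_map_one (D : Der K n) : D.1 1 = 0 := by
  have h := der_map_mul D 1 1
  simpa using h

theorem der_map_algebraMap (D : Der K n) (r : K) : D.1 (algebraMap K (T K n) r) = 0 := by
  rw [Algebra.algebraMap_eq_smul_one, map_smul, der_map_one D, smul_zero]

theorem der_ext_X {D E : Der K n} (h : ∀ i, D.1 (X K i) = E.1 (X K i)) : D = E := by
  apply Subtype.ext
  ext a
  induction a using FreeAlgebra.induction with
  | grade0 r => rw [der_map_algebraMap D, der_map_algebraMap E]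
  | grade1 i => exact h i
  | mul a b ha hb => rw [der_map_mul D, der_map_mul E, ha, hb]
  | add a b ha hb => rw [map_add, map_add, ha, hb]

/-- The algebra morphism `a ↦ a + ε D(a)` into the dual numbers over `T(A_n)`, where `D` is the
derivation with `D(x_i) = g i`. -/
noncomputable def dualLift (g : Fin n → T K n) : T K n →ₐ[K] TrivSqZeroExt (T K n) (T K n) :=
  FreeAlgebra.lift K fun i => TrivSqZeroExt.inl (X K i) + TrivSqZeroExt.inr (g i)

theorem fst_dualLift (g : Fin n → T K n) (a : T K n) : (dualLift g a).fst = a := by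
  have h : (TrivSqZeroExt.fstHom K (T K n) (T K n)).comp (dualLift g) = AlgHom.id K _ := by
    ext i
    simp [dualLift]
  exact DFunLike.congr_fun h a

/-- The derivation of `T(A_n)` with `x_i ↦ a` that kills all other generators. -/
noncomputable def der (i : Fin n) (a : T K n) : Der K n where
  val := TrivSqZeroExt.sndHom (T K n) (T K n) |>.restrictScalars K |>.comp
    (dualLift (Pi.single i a)).toLinearMap
  property b c := by
    change (dualLift _ (b * c)).snd = (dualLift _ b).snd * c + b * (dualLift _ c).snd
    rw [map_mul, TrivSqZeroExt.snd_mul, fst_dualLift, fst_dualLift, smul_eq_mul,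
      op_smul_eq_mul, add_comm]

theorem der_X (i j : Fin n) (a : T K n) :
    (der i a).1 (X K j) = (Pi.single i a : Fin n → T K n) j := by
  change (dualLift _ (FreeAlgebra.ι K j)).snd = _
  simp [dualLift]

@[simp] theorem der_X_self (i : Fin n) (a : T K n) : (der i a).1 (X K i) = a := by
  rw [der_X, Pi.single_eq_same]

theorem der_X_of_ne {i j : Fin n} (h : j ≠ i) (a : T K n) : (der i a).1 (X K j) = 0 := by
  rw [der_X, Pi.single_eq_of_ne h]

/-- `der i` as a linear map. -/
noncomputable def derLin (i : Fin n) : T K n →ₗ[K] Der K n where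
  toFun := der i
  map_add' a b := der_ext_X fun j => by
    change _ = (der i a).1 _ + (der i b).1 _
    simp only [der_X, Pi.single_add, Pi.add_apply]
  map_smul' r a := der_ext_X fun j => by
    change _ = r • (der i a).1 _
    simp only [der_X, Pi.single_smul, Pi.smul_apply]

theorem derLin_apply (i : Fin n) (a : T K n) : derLin i a = der i a := rfl

theorem der_eq_sum (D : Der K n) : D = ∑ i, der i (D.1 (X K i)) := by
  refine der_ext_X fun j => ?_
  have h : (∑ i, der i (D.1 (X K i))).1 = ∑ i, (der i (D.1 (X K i))).1 :=
    map_sum (Der K n).toSubmodule.subtype _ _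
  rw [h, LinearMap.sum_apply, Finset.sum_eq_single j]
  · simp
  · intro i _ hij
    exact der_X_of_ne hij.symm _
  · simp

/-- A commutator with `der i a` is read off from the values on the generators. -/
theorem lie_der (D : Der K n) (i : Fin n) (a : T K n) :
    ⁅D, der i a⁆ = der i (D.1 a) - ∑ j, der j ((der i a).1 (D.1 (X K j))) := by
  rw [der_eq_sum ⁅D, der i a⁆]
  simp only [lie_apply, ← derLin_apply, map_sub, Finset.sum_sub_distrib]
  congr 1
  rw [Finset.sum_eq_single i]
  · simp [derLin_apply]
  · intro j _ hj
    rw [derLin_apply i, der_X_of_ne hj, map_zero, map_zero]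
  · simp

/-- The bracket `[a ∂_l, b ∂_i]`. -/
theorem lie_der_der (l i : Fin n) (a b : T K n) :
    ⁅der l a, der i b⁆ = der i ((der l a).1 b) - der l ((der i b).1 a) := by
  rw [lie_der]
  congr 1
  rw [Finset.sum_eq_single l]
  · simp
  · intro j _ hj
    rw [der_X_of_ne hj, map_zero, ← derLin_apply, map_zero]
  · simp

/-! ### Cyclic words -/

/-- The projection `a ↦ |a|`. -/
def cyc (K : Type*) [Field K] (n : ℕ) : T K n →ₗ[K] Cyc K n := (commutatorSpan K n).mkQ

theorem cyc_surjective : Function.Surjective (cyc K n) := (commutatorSpan K n).mkQ_surjective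

theorem cyc_mul_comm (a b : T K n) : cyc K n (a * b) = cyc K n (b * a) := by
  rw [← sub_eq_zero, ← map_sub]
  exact (Submodule.Quotient.mk_eq_zero _).2 (Submodule.subset_span ⟨a, b, rfl⟩)

theorem lie_cyc (D : Der K n) (a : T K n) : ⁅D, cyc K n a⁆ = cyc K n (D.1 a) := rfl

/-- A linear functional that is symmetric on products of words vanishes on all commutators. -/
theorem commutatorSpan_le_ker {φ : T K n →ₗ[K] K}
    (h : ∀ L M, φ (word K (L ++ M)) = φ (word K (M ++ L))) :
    commutatorSpan K n ≤ LinearMap.ker φ := by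
  have h2 : (LinearMap.mul K (T K n)).compr₂ φ = ((LinearMap.mul K (T K n)).compr₂ φ).flip :=
    linearMap_ext_word fun L => linearMap_ext_word fun M => by
      simpa [word_append] using h L M
  refine Submodule.span_le.2 ?_
  rintro _ ⟨a, b, rfl⟩
  have h3 : φ (a * b) = φ (b * a) := LinearMap.congr_fun₂ h2 a b
  simp [h3]

open Classical in
/-- The linear functional on `T(A_n)` that is `1` on the rotations of the word `L` and `0` on all
other words. -/
noncomputable def rotForm (K : Type*) [Field K] {n : ℕ} (L : List (Fin n)) : T K n →ₗ[K] K :=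
  (wordBasis K n).constr K fun M => if M ~r L then (1 : K) else 0

open Classical in
theorem rotForm_word (L M : List (Fin n)) :
    rotForm K L (word K M) = if M ~r L then (1 : K) else 0 := by
  rw [← wordBasis_apply]
  exact (wordBasis K n).constr_basis K _ M

/-- The functional induced by `rotForm` on cyclic words. -/
noncomputable def rotCoeff (K : Type*) [Field K] {n : ℕ} (L : List (Fin n)) : Cyc K n →ₗ[K] K :=
  (commutatorSpan K n).liftQ (rotForm K L) <| commutatorSpan_le_ker fun M N => by
    rw [rotForm_word, rotForm_word]
    have h : (M ++ N ~r L) ↔ (N ++ M ~r L) :=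
      ⟨List.isRotated_append.trans, List.isRotated_append.trans⟩
    simp only [h]

theorem rotCoeff_cyc (L : List (Fin n)) (a : T K n) : rotCoeff K L (cyc K n a) = rotForm K L a :=
  rfl

/-- The only rotation of `z w₀` of the form `z w` is `z w₀` itself if `z = x^N y` with `x ≠ y` and
`N` is at least the length of `w₀`. -/
theorem eq_of_isRotated {α : Type*} {x y : α} (hxy : x ≠ y) {N : ℕ} {w w₀ : List α}
    (hN : w₀.length ≤ N)
    (h : (List.replicate N x ++ y :: w) ~r (List.replicate N x ++ y :: w₀)) : w = w₀ := by
  obtain ⟨i, hi, hrot⟩ := List.isRotated_iff_mod.1 h.symm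
  have hlen := congrArg List.length hrot
  simp only [List.length_rotate, List.length_append, List.length_replicate,
    List.length_cons] at hlen hi
  have key : ∀ k (hk : k < N + 1), (List.replicate N x ++ y :: w)[k]? =
      (List.replicate N x ++ y :: w₀)[(k + i) % (N + (w₀.length + 1))]? := by
    intro k hk
    rw [← hrot, List.getElem?_rotate]
    · simp
    · simp; omega
  rcases Nat.eq_zero_or_pos i with rfl | hpos
  · simpa using hrot.symm
  rcases Nat.eq_or_lt_of_le hi with heq | hlt
  · rw [show i = (List.replicate N x ++ y :: w₀).length by simp [heq], List.rotate_length] at hrot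
    simpa using hrot.symm
  exfalso
  by_cases hiN : i ≤ N
  · -- the letter `y` after `x^N` in `z w₀` would be one of the letters `x` of `z` in the rotation
    have h1 := key (N - i) (by omega)
    rw [Nat.mod_eq_of_lt (by omega), List.getElem?_append_left (by simp; omega),
      List.getElem?_append_right (by simp; omega)] at h1
    have h2 : N - i + i - N = 0 := by omega
    simp [h2, List.getElem?_replicate] at h1
    exact hxy h1.2
  · -- the letter `y` after `x^N` in the rotation would be one of the letters `x` of `z` in `z w₀`
    have h1 := key N (by omega)
    rw [show N + i = (N + i - (N + (w₀.length + 1))) + (N + (w₀.length + 1)) by omega,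
      Nat.add_mod_right, Nat.mod_eq_of_lt (by omega), List.getElem?_append_right (by simp),
      List.getElem?_append_left (by simp; omega)] at h1
    simp [List.getElem?_replicate] at h1
    exact hxy h1.2.symm

/-- The pairing `(z, a) ↦ |z a|` detects `a` even when `z` runs only over words in two letters. -/
theorem eq_zero_of_forall_cyc {x y : Fin n} (hxy : x ≠ y) {a : T K n}
    (h : ∀ N, cyc K n (word K (List.replicate N x ++ [y]) * a) = 0) : a = 0 := by
  classical
  refine (wordBasis K n).ext_elem fun w₀ => ?_
  have h1 := congrArg (rotCoeff K (List.replicate w₀.length x ++ y :: w₀)) (h w₀.length)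
  rw [map_zero, rotCoeff_cyc] at h1
  have h2 : (rotForm K (List.replicate w₀.length x ++ y :: w₀)) ∘ₗ
      LinearMap.mulLeft K (word K (List.replicate w₀.length x ++ [y])) =
      (wordBasis K n).coord w₀ := by
    refine linearMap_ext_word fun w => ?_
    rw [LinearMap.comp_apply, LinearMap.mulLeft_apply, ← word_append, rotForm_word,
      ← wordBasis_apply, Module.Basis.coord_apply, Module.Basis.repr_self,
      Finsupp.single_apply, List.append_assoc, List.singleton_append]
    congr 1
    exact propext ⟨eq_of_isRotated hxy le_rfl, fun h => h ▸ List.IsRotated.refl _⟩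
  rw [map_zero, Finsupp.zero_apply, ← Module.Basis.coord_apply, ← h2]
  exact h1

/-! ### Degrees -/

theorem word_mem_homogeneousPart (L : List (Fin n)) :
    word K L ∈ homogeneousPart K n L.length :=
  Submodule.subset_span ⟨L, rfl, rfl⟩

theorem homogeneousPart_induction {d : ℤ} {S : Submodule K (T K n)}
    (h : ∀ L : List (Fin n), (L.length : ℤ) = d → word K L ∈ S) : homogeneousPart K n d ≤ S := by
  refine Submodule.span_le.2 ?_
  rintro _ ⟨L, hL, rfl⟩
  exact h L hL

theorem mul_mem_homogeneousPart {d e : ℤ} {a b : T K n} (ha : a ∈ homogeneousPart K n d)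
    (hb : b ∈ homogeneousPart K n e) : a * b ∈ homogeneousPart K n (d + e) := by
  have h : homogeneousPart K n d * homogeneousPart K n e ≤ homogeneousPart K n (d + e) := by
    rw [homogeneousPart, homogeneousPart, Submodule.span_mul_span]
    refine Submodule.span_le.2 ?_
    rintro _ ⟨_, ⟨L, hL, rfl⟩, _, ⟨M, hM, rfl⟩, rfl⟩
    exact Submodule.subset_span ⟨L ++ M, by simp [hL, hM], by simp⟩
  exact h (Submodule.mul_mem_mul ha hb)

theorem der_mem_derPart (i : Fin n) {k : ℤ} {a : T K n} (ha : a ∈ homogeneousPart K n (k + 1)) :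
    der i a ∈ derPart K n k := by
  intro m
  refine homogeneousPart_induction (S := (homogeneousPart K n (m + k)).comap (der i a).1) ?_
  intro L hL
  subst hL
  change (der i a).1 (word K L) ∈ homogeneousPart K n _
  induction L with
  | nil => rw [word_nil, der_map_one]; exact Submodule.zero_mem _
  | cons j L ih =>
    rw [word_cons, der_map_mul]
    refine Submodule.add_mem _ ?_ ?_
    · rcases eq_or_ne j i with rfl | hj
      · rw [der_X_self]
        convert mul_mem_homogeneousPart ha (word_mem_homogeneousPart (K := K) L) using 1
        simp; ring_nf
      · rw [der_X_of_ne hj, zero_mul]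
        exact Submodule.zero_mem _
    · have hj : X K j ∈ homogeneousPart K n 1 := by
        simpa [word] using word_mem_homogeneousPart (K := K) [j]
      convert mul_mem_homogeneousPart hj ih using 1
      simp; ring_nf

/-- Cyclic words of degree zero are killed by all derivations. -/
theorem lie_eq_zero_of_mem_cycPart_zero {ω : Cyc K n} (hω : ω ∈ cycPart K n 0) (D : Der K n) :
    ⁅D, ω⁆ = 0 := by
  obtain ⟨a, ha, rfl⟩ := hω
  have h : homogeneousPart K n 0 ≤ LinearMap.ker D.1 := homogeneousPart_induction fun L hL => by
    have : L = [] := by simpa using hL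
    rw [this, word_nil, LinearMap.mem_ker, der_map_one]
  change cyc K n (D.1 a) = 0
  rw [LinearMap.mem_ker.1 (h ha), map_zero]

/-! ### The weight of a letter -/

/-- The derivation `x_l ∂_l`, which multiplies a word by the number of its letters `x_l`. -/
noncomputable def euler (K : Type*) [Field K] {n : ℕ} (l : Fin n) : Der K n := der l (X K l)

theorem euler_word (l : Fin n) (L : List (Fin n)) :
    (euler K l).1 (word K L) = (L.count l : K) • word K L := by
  induction L with
  | nil => simp [der_map_one]
  | cons j L ih =>
    rw [word_cons, der_map_mul, ih]
    rcases eq_or_ne j l with rfl | hj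
    · rw [euler, der_X_self, List.count_cons_self, mul_smul_comm]
      push_cast
      rw [add_smul, one_smul, add_comm]
    · rw [euler, der_X_of_ne hj, List.count_cons_of_ne hj, zero_mul, zero_add, mul_smul_comm]

theorem mem_span_of_euler_eq [CharZero K] {l : Fin n} {k : ℕ} {a : T K n}
    (h : (euler K l).1 a = (k : K) • a) :
    a ∈ Submodule.span K (word K '' {L : List (Fin n) | L.count l = k}) := by
  have hcoord : ∀ L, (wordBasis K n).repr a L ≠ 0 → L.count l = k := by
    intro L hL
    have h1 : (wordBasis K n).coord L ∘ₗ (euler K l).1 =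
        (L.count l : K) • (wordBasis K n).coord L := by
      refine linearMap_ext_word fun M => ?_
      rw [LinearMap.comp_apply, euler_word, map_smul, LinearMap.smul_apply, ← wordBasis_apply,
        Module.Basis.coord_apply, Module.Basis.repr_self]
      rcases eq_or_ne M L with rfl | hM
      · rfl
      · simp [Finsupp.single_eq_of_ne hM.symm]
    have h2 := LinearMap.congr_fun h1 a
    rw [LinearMap.comp_apply, h, map_smul, LinearMap.smul_apply, Module.Basis.coord_apply,
      smul_eq_mul, smul_eq_mul] at h2
    exact_mod_cast (mul_right_cancel₀ hL h2).symm
  rw [← (wordBasis K n).linearCombination_repr a, Finsupp.linearCombination_apply]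
  refine Submodule.sum_mem _ fun L hL => Submodule.smul_mem _ _ (Submodule.subset_span ?_)
  exact ⟨L, hcoord L (Finsupp.mem_support_iff.1 hL), (wordBasis_apply L).symm⟩

/-- The weights of cyclic words are natural numbers; in particular `-1` is not a weight. -/
theorem eq_zero_of_lie_euler_eq_neg [CharZero K] {l : Fin n} {ω : Cyc K n}
    (h : ⁅euler K l, ω⁆ = -ω) : ω = 0 := by
  set f : Module.End K (Cyc K n) := onCyc (euler K l)
  have htop : ⨆ (μ : K) (_ : μ ≠ -1), f.eigenspace μ = ⊤ := by
    refine eq_top_iff.2 ?_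
    have h1 : (⊤ : Submodule K (Cyc K n)) =
        (Submodule.span K (Set.range (word K (n := n)))).map (cyc K n) := by
      rw [span_word, Submodule.map_top, LinearMap.range_eq_top.2 cyc_surjective]
    rw [h1, Submodule.map_span, Submodule.span_le]
    rintro _ ⟨_, ⟨L, rfl⟩, rfl⟩
    have hne : (L.count l : K) ≠ -1 := by
      intro h0
      have : ((L.count l + 1 : ℕ) : K) = 0 := by push_cast; rw [h0]; ring
      exact absurd (Nat.cast_eq_zero.1 this) (Nat.succ_ne_zero _)
    refine Submodule.mem_iSup_of_mem _ (Submodule.mem_iSup_of_mem hne ?_)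
    rw [Module.End.mem_eigenspace_iff]
    change cyc K n ((euler K l).1 (word K L)) = _
    rw [euler_word, map_smul]
  have hdisj := f.eigenspaces_iSupIndep (-1)
  rw [htop, disjoint_top] at hdisj
  have hmem : ω ∈ f.eigenspace (-1) := by
    rw [Module.End.mem_eigenspace_iff, neg_smul, one_smul]
    exact h
  rwa [hdisj, Submodule.mem_bot] at hmem

/-- The subalgebra of `T(A_n)` generated by the letters other than `x_l`. -/
def avoid (K : Type*) [Field K] {n : ℕ} (l : Fin n) : Subalgebra K (T K n) :=
  Algebra.adjoin K {a | ∃ i, i ≠ l ∧ a = X K i}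

theorem X_mem_avoid {i l : Fin n} (h : i ≠ l) : X K i ∈ avoid K l :=
  Algebra.subset_adjoin ⟨i, h, rfl⟩

theorem word_mem_avoid {l : Fin n} {L : List (Fin n)} (h : l ∉ L) : word K L ∈ avoid K l := by
  induction L with
  | nil => exact one_mem _
  | cons j L ih =>
    rw [List.mem_cons, not_or] at h
    rw [word_cons]
    exact mul_mem (X_mem_avoid (Ne.symm h.1)) (ih h.2)

theorem der_avoid {l : Fin n} {z : T K n} (hz : z ∈ avoid K l) (a : T K n) :
    (der l a).1 z = 0 := by
  induction hz using Algebra.adjoin_induction with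
  | mem _ h => obtain ⟨i, hi, rfl⟩ := h; exact der_X_of_ne hi a
  | algebraMap r => exact der_map_algebraMap _ r
  | add _ _ _ _ h1 h2 => rw [map_add, h1, h2, add_zero]
  | mul _ _ _ _ h1 h2 => rw [der_map_mul, h1, h2, zero_mul, mul_zero, add_zero]

theorem der_mem_avoid {i l : Fin n} {z w : T K n} (hz : z ∈ avoid K l) (hw : w ∈ avoid K l) :
    (der i z).1 w ∈ avoid K l := by
  induction hw using Algebra.adjoin_induction with
  | mem _ h =>
    obtain ⟨j, hj, rfl⟩ := h
    rcases eq_or_ne j i with rfl | hji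
    · rwa [der_X_self]
    · rw [der_X_of_ne hji]; exact zero_mem _
  | algebraMap r => rw [der_map_algebraMap]; exact zero_mem _
  | add _ _ _ _ h1 h2 => rw [map_add]; exact add_mem h1 h2
  | mul _ _ hx hy h1 h2 =>
    rw [der_map_mul]
    exact add_mem (mul_mem h1 hy) (mul_mem hx h2)

theorem lie_euler_der {l : Fin n} {z : T K n} (hz : z ∈ avoid K l) :
    ⁅euler K l, der l z⁆ = -der l z := by
  rw [euler, lie_der_der, der_avoid hz, der_X_self, ← derLin_apply, map_zero, zero_sub]

theorem lie_euler_der_of_ne {i l : Fin n} (hi : i ≠ l) {z : T K n} (hz : z ∈ avoid K l) :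
    ⁅euler K l, der i z⁆ = 0 := by
  rw [euler, lie_der_der, der_avoid hz, der_X_of_ne hi.symm, ← derLin_apply, ← derLin_apply,
    map_zero, map_zero, sub_zero]

/-! ### Cyclic derivatives -/

/-- The action of `z ∂_l` on a cyclic word is `|z η|`, where `η` does not depend on `z`: it is the
cyclic derivative of the word with respect to `x_l`. -/
theorem exists_cyclicDerivative (l : Fin n) (a : T K n) :
    ∃ η : T K n, ∀ z, cyc K n ((der l z).1 a) = cyc K n (z * η) := by
  -- for the induction, insert `∂_l a` into an arbitrary context `b`
  suffices h : ∀ b, ∃ η : T K n, ∀ z, cyc K n ((der l z).1 a * b) = cyc K n (z * η) by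
    simpa using h 1
  induction a using FreeAlgebra.induction with
  | grade0 r => exact fun b => ⟨0, fun z => by rw [der_map_algebraMap]; simp⟩
  | grade1 i =>
    intro b
    rcases eq_or_ne i l with rfl | hi
    · exact ⟨b, fun z => by rw [der_X_self]⟩
    · exact ⟨0, fun z => by rw [der_X_of_ne hi]; simp⟩
  | mul a a' ha ha' =>
    intro b
    obtain ⟨η, hη⟩ := ha (a' * b)
    obtain ⟨η', hη'⟩ := ha' (b * a)
    refine ⟨η + η', fun z => ?_⟩
    rw [der_map_mul, add_mul, map_add, mul_assoc, hη, mul_assoc, cyc_mul_comm a, mul_assoc, hη',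
      mul_add, map_add]
  | add a a' ha ha' =>
    intro b
    obtain ⟨η, hη⟩ := ha b
    obtain ⟨η', hη'⟩ := ha' b
    exact ⟨η + η', fun z => by rw [map_add, add_mul, map_add, hη, hη', mul_add, map_add]⟩

theorem eq_zero_of_forall_avoid {l x y : Fin n} (hxl : x ≠ l) (hyl : y ≠ l) (hxy : x ≠ y)
    {a : T K n} (h : ∀ z ∈ avoid K l, cyc K n (z * a) = 0) : a = 0 := by
  refine eq_zero_of_forall_cyc hxy fun N => h _ (word_mem_avoid ?_)
  simp [hyl.symm, List.mem_replicate, hxl.symm]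

/-- A cyclic element of weight zero in `x_l` is killed by all derivations `z ∂_l`. -/
theorem lie_der_eq_zero_of_lie_euler_eq_zero [CharZero K] {l x y : Fin n} (hxl : x ≠ l)
    (hyl : y ≠ l) (hxy : x ≠ y) {ω : Cyc K n} (h : ⁅euler K l, ω⁆ = 0) (z : T K n) :
    ⁅der l z, ω⁆ = 0 := by
  obtain ⟨a, rfl⟩ := cyc_surjective ω
  obtain ⟨η, hη⟩ := exists_cyclicDerivative l a
  have hη0 : η = 0 := eq_zero_of_forall_avoid hxl hyl hxy fun z hz => by
    rw [← hη]
    refine eq_zero_of_lie_euler_eq_neg (l := l) ?_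
    rw [← lie_cyc, leibniz_lie, h, lie_zero, add_zero, lie_euler_der hz, neg_lie]
  rw [lie_cyc, hη, hη0, mul_zero, map_zero]

/-- A cyclic element of nonzero weight in `x_l` is detected by the derivations `z ∂_l`, where `z`
runs over the elements without `x_l`. -/
theorem eq_zero_of_forall_lie_der {l x y : Fin n} (hxl : x ≠ l) (hyl : y ≠ l) (hxy : x ≠ y)
    {ω : Cyc K n} {r : K} (hr : r ≠ 0) (h : ⁅euler K l, ω⁆ = r • ω)
    (hz : ∀ z ∈ avoid K l, ⁅der l z, ω⁆ = 0) : ω = 0 := by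
  obtain ⟨a, rfl⟩ := cyc_surjective ω
  obtain ⟨η, hη⟩ := exists_cyclicDerivative l a
  have hη0 : η = 0 := eq_zero_of_forall_avoid hxl hyl hxy fun z hz' => by
    rw [← hη, ← lie_cyc, hz z hz']
  rw [lie_cyc, euler, hη, hη0, mul_zero, map_zero] at h
  exact (smul_eq_zero.1 h.symm).resolve_left hr

/-! ### Cocycles and weights -/

section Cocycle

variable {c : Der K n →ₗ[K] Cyc K n}

theorem lie_euler_cocycle (hc : IsOneCocycle c) (hdeg : IsDegreeZero c) {l : Fin n} {v : Der K n}
    {r : K} (hv : ⁅euler K l, v⁆ = r • v) : ⁅euler K l, c v⁆ = r • c v := by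
  have hX : X K l ∈ homogeneousPart K n (0 + 1) := by
    simpa [word] using word_mem_homogeneousPart (K := K) [l]
  have h := hc (euler K l) v
  have h0 : c (euler K l) ∈ cycPart K n 0 := hdeg 0 _ (der_mem_derPart l hX)
  rw [hv, map_smul, lie_eq_zero_of_mem_cycPart_zero h0, sub_zero] at h
  exact h.symm

/-- A cocycle kills the derivations of negative weight. -/
theorem cocycle_eq_zero_of_weight_neg [CharZero K] (hc : IsOneCocycle c) (hdeg : IsDegreeZero c)
    {l : Fin n} {v : Der K n} (hv : ⁅euler K l, v⁆ = -v) : c v = 0 := by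
  refine eq_zero_of_lie_euler_eq_neg (l := l) ?_
  rw [lie_euler_cocycle hc hdeg (r := -1) (by rw [hv, neg_smul, one_smul]), neg_smul, one_smul]

theorem cocycle_der_avoid [CharZero K] (hc : IsOneCocycle c) (hdeg : IsDegreeZero c)
    {l : Fin n} {z : T K n} (hz : z ∈ avoid K l) : c (der l z) = 0 :=
  cocycle_eq_zero_of_weight_neg hc hdeg (lie_euler_der hz)

/-- The weight in `x_l` can be lowered to zero by the derivations `z ∂_l` without losing
information about the cocycle. -/
theorem cocycle_eq_zero_of_weight [CharZero K] (hc : IsOneCocycle c) (hdeg : IsDegreeZero c)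
    {l x y : Fin n} (hxl : x ≠ l) (hyl : y ≠ l) (hxy : x ≠ y)
    (h0 : ∀ v : Der K n, ⁅euler K l, v⁆ = 0 → c v = 0) (r : ℕ) (v : Der K n)
    (hv : ⁅euler K l, v⁆ = (r : K) • v) : c v = 0 := by
  induction r generalizing v with
  | zero => exact h0 v (by simpa using hv)
  | succ r ih =>
    refine eq_zero_of_forall_lie_der hxl hyl hxy (Nat.cast_ne_zero.2 r.succ_ne_zero)
      (lie_euler_cocycle hc hdeg hv) fun z hz => ?_
    have h1 := hc (der l z) v
    rw [cocycle_der_avoid hc hdeg hz, lie_zero, sub_zero] at h1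
    rw [← h1]
    refine ih _ ?_
    rw [leibniz_lie, hv, lie_euler_der hz, neg_lie, lie_smul]
    push_cast
    rw [add_smul, one_smul]
    abel

/-! ### Derivations of weight zero -/

/-- The derivation `(α x_l β) ∂_l`. -/
noncomputable def insDer (l : Fin n) (α β : T K n) : Der K n := der l (α * X K l * β)

theorem lie_der_insDer {i l : Fin n} (hi : i ≠ l) {z α β : T K n} (hz : z ∈ avoid K l) :
    ⁅der i z, insDer l α β⁆ =
      insDer l ((der i z).1 α) β + insDer l α ((der i z).1 β) := by
  rw [insDer, lie_der_der, der_avoid hz, der_map_mul, der_map_mul, der_X_of_ne hi.symm]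
  simp only [insDer, ← derLin_apply, map_zero, mul_zero, add_zero, sub_zero, map_add]

/-- On the derivations `(α x_l β) ∂_l` a cocycle is equivariant under the derivations of the
subalgebra without `x_l`. -/
theorem lie_der_cocycle_insDer [CharZero K] (hc : IsOneCocycle c) (hdeg : IsDegreeZero c)
    {i l x y : Fin n} (hxl : x ≠ l) (hyl : y ≠ l) (hxy : x ≠ y) (hi : i ≠ l) {z α β : T K n}
    (hz : z ∈ avoid K l) :
    ⁅der i z, c (insDer l α β)⁆ =
      c (insDer l ((der i z).1 α) β) + c (insDer l α ((der i z).1 β)) := by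
  have h := hc (der i z) (insDer l α β)
  have h0 : ⁅euler K l, c (der i z)⁆ = 0 := by
    rw [lie_euler_cocycle hc hdeg (r := 0), zero_smul]
    rw [lie_euler_der_of_ne hi hz, zero_smul]
  rw [lie_der_insDer hi hz, map_add, insDer, insDer, insDer,
    lie_der_eq_zero_of_lie_euler_eq_zero hxl hyl hxy h0, sub_zero] at h
  exact h.symm

theorem exists_smul_of_mem_homogeneousPart_one {i : Fin n} {a : T K n}
    (ha : a ∈ homogeneousPart K n 1) : ∃ r : K, ∀ z, (der i z).1 a = r • z := by
  induction ha using Submodule.span_induction with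
  | mem _ h =>
    obtain ⟨L, hL, rfl⟩ := h
    obtain ⟨j, rfl⟩ := List.length_eq_one_iff.1 (by exact_mod_cast hL : L.length = 1)
    rcases eq_or_ne j i with rfl | hj
    · exact ⟨1, fun z => by simp⟩
    · exact ⟨0, fun z => by simp [der_X_of_ne hj]⟩
  | zero => exact ⟨0, by simp⟩
  | add _ _ _ _ h1 h2 =>
    obtain ⟨r, hr⟩ := h1
    obtain ⟨s, hs⟩ := h2
    exact ⟨r + s, fun z => by rw [map_add, hr, hs, add_smul]⟩
  | smul t _ _ h =>
    obtain ⟨r, hr⟩ := h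
    exact ⟨t * r, fun z => by rw [map_smul, hr, mul_smul]⟩

theorem exists_linear_of_mem_cycPart_two (i : Fin n) {ω : Cyc K n} (hω : ω ∈ cycPart K n 2) :
    ∃ η ∈ homogeneousPart K n 1, ∀ z, ⁅der i z, ω⁆ = cyc K n (z * η) := by
  obtain ⟨a, ha, rfl⟩ := hω
  change ∃ η ∈ homogeneousPart K n 1, ∀ z, cyc K n ((der i z).1 a) = cyc K n (z * η)
  have hX : ∀ j, X K j ∈ homogeneousPart K n 1 := fun j => by
    simpa [word] using word_mem_homogeneousPart (K := K) [j]
  have hlin : ∀ j, ∃ r : K, ∀ z, (der i z).1 (X K j) = r • z := fun j =>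
    exists_smul_of_mem_homogeneousPart_one (hX j)
  induction ha using Submodule.span_induction with
  | mem _ h =>
    obtain ⟨L, hL, rfl⟩ := h
    obtain ⟨p, q, rfl⟩ := List.length_eq_two.1 (by exact_mod_cast hL : L.length = 2)
    obtain ⟨r, hr⟩ := hlin p
    obtain ⟨s, hs⟩ := hlin q
    refine ⟨r • X K q + s • X K p, add_mem (Submodule.smul_mem _ _ (hX q))
      (Submodule.smul_mem _ _ (hX p)), fun z => ?_⟩
    have hpq : (List.map (FreeAlgebra.ι K) [p, q]).prod = X K p * X K q := by simp
    rw [hpq, der_map_mul, hr, hs, map_add, mul_add, map_add, mul_smul_comm, mul_smul_comm,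
      mul_smul_comm, smul_mul_assoc, map_smul, map_smul, cyc_mul_comm (X K p), map_smul _ s]
  | zero => exact ⟨0, zero_mem _, by simp⟩
  | add _ _ _ _ h1 h2 =>
    obtain ⟨η, h, hη⟩ := h1
    obtain ⟨η', h', hη'⟩ := h2
    exact ⟨η + η', add_mem h h', fun z => by
      rw [map_add, map_add, hη, hη', mul_add, map_add]⟩
  | smul t _ _ h =>
    obtain ⟨η, h, hη⟩ := h
    exact ⟨t • η, Submodule.smul_mem _ _ h, fun z => by
      rw [map_smul, map_smul, hη, mul_smul_comm, map_smul]⟩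

/-- Equivariance determines a cocycle on the derivations `(α x_l β) ∂_l` up to a scalar: the value
at `α = x`, `β = y` is of degree two, and substituting for `x` and for `y` gives all others. -/
theorem exists_cocycle_insDer [CharZero K] (hc : IsOneCocycle c) (hdeg : IsDegreeZero c)
    {l x y : Fin n} (hxl : x ≠ l) (hyl : y ≠ l) (hxy : x ≠ y) :
    ∃ κ : K, ∀ α ∈ avoid K l, ∀ β ∈ avoid K l, c (insDer l α β) = κ • cyc K n (α * β) := by
  have hmem : c (insDer l (X K x) (X K y)) ∈ cycPart K n 2 := by
    refine hdeg 2 _ (der_mem_derPart l ?_)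
    simpa [word, mul_assoc] using word_mem_homogeneousPart (K := K) [x, l, y]
  obtain ⟨η, hη, hxη⟩ := exists_linear_of_mem_cycPart_two x hmem
  obtain ⟨κ, hκ⟩ := exists_smul_of_mem_homogeneousPart_one (i := y) hη
  -- substitute `α` for `x`
  have h1 : ∀ α ∈ avoid K l, c (insDer l α (X K y)) = cyc K n (α * η) := fun α hα => by
    rw [← hxη, lie_der_cocycle_insDer hc hdeg hxl hyl hxy hxl hα, der_X_self,
      der_X_of_ne hxy.symm]
    simp [insDer, ← derLin_apply]
  refine ⟨κ, fun α hα β hβ => ?_⟩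
  -- substitute `β` for `y`
  have h2 := lie_der_cocycle_insDer hc hdeg hxl hyl hxy hyl hβ (α := α) (β := X K y)
  rw [h1 α hα, h1 _ (der_mem_avoid hβ hα), der_X_self, lie_cyc, der_map_mul, map_add, hκ,
    add_right_inj, mul_smul_comm, map_smul] at h2
  exact h2.symm

/-- The value of a cocycle on `(z q) ∂_i` comes from the bracket of `z ∂_l` with `(x_l q) ∂_i`, both
of which it kills. On the right, the letters `x_i` of `z` are replaced by `x_l q`, one at a time. -/
theorem cocycle_der_mul [CharZero K] (hc : IsOneCocycle c) (hdeg : IsDegreeZero c)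
    {i l : Fin n} (hi : i ≠ l) {z q : T K n} (hz : z ∈ avoid K l) (hql : q ∈ avoid K l)
    (hqi : q ∈ avoid K i) :
    c (der i (z * q)) = c (der l ((der i (X K l * q)).1 z)) := by
  have h := hc (der l z) (der i (X K l * q))
  rw [cocycle_der_avoid hc hdeg hz, cocycle_der_avoid hc hdeg (mul_mem (X_mem_avoid hi.symm) hqi),
    lie_zero, lie_zero, sub_zero, lie_der_der, der_map_mul, der_X_self, der_avoid hql, mul_zero,
    add_zero, map_sub, sub_eq_zero] at h
  exact h

theorem cocycle_insDer [CharZero K] (hc : IsOneCocycle c) (hdeg : IsDegreeZero c)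
    {l x y : Fin n} (hxl : x ≠ l) (hyl : y ≠ l) (hxy : x ≠ y) {α β : T K n}
    (hα : α ∈ avoid K l) (hβ : β ∈ avoid K l) : c (insDer l α β) = 0 := by
  obtain ⟨κ, hκ⟩ := exists_cocycle_insDer hc hdeg hxl hyl hxy
  suffices h : κ = 0 by rw [hκ α hα β hβ, h, zero_smul]
  have hx := X_mem_avoid (K := K) hxl
  have hy := X_mem_avoid (K := K) hyl
  have hyx := X_mem_avoid (K := K) hxy.symm
  have h1l : (1 : T K n) ∈ avoid K l := one_mem _
  -- two expressions for the value at `(x y x x y) ∂_x`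
  set z : T K n := X K x * X K y * X K x * X K x
  have hz : z ∈ avoid K l := mul_mem (mul_mem (mul_mem hx hy) hx) hx
  have hrot1 : cyc K n (X K y * X K x * X K x * X K y) = cyc K n (word K [x, x, y, y]) := by
    rw [mul_assoc, mul_assoc, cyc_mul_comm]
    simp [word, mul_assoc]
  have hrot2 : cyc K n (X K y * X K y * X K x * X K x) = cyc K n (word K [x, x, y, y]) := by
    rw [mul_assoc, cyc_mul_comm]
    simp [word, mul_assoc]
  have hrot3 : cyc K n (X K x * X K y * (X K y * X K x)) = cyc K n (word K [x, x, y, y]) := by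
    rw [← mul_assoc, cyc_mul_comm]
    simp [word, mul_assoc]
  have e1 : c (der x (z * X K y)) = κ • cyc K n (word K [x, x, y, y]) +
      (2 * κ) • cyc K n (word K [x, y, x, y]) := by
    have hsum : (der x (X K l * 1)).1 (z * X K y) =
        1 * X K l * (X K y * X K x * X K x * X K y) +
          X K x * X K y * X K l * (X K x * X K y) +
          X K x * X K y * X K x * X K l * X K y := by
      simp only [z, der_map_mul, der_X_self, der_X_of_ne hxy.symm]
      noncomm_ring
    rw [← mul_one (z * X K y), cocycle_der_mul hc hdeg hxl (mul_mem hz hy) h1l (one_mem _), hsum,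
      ← derLin_apply, map_add, map_add, map_add, map_add]
    change c (insDer l _ _) + c (insDer l _ _) + c (insDer l _ _) = _
    rw [hκ _ h1l _ (mul_mem (mul_mem (mul_mem hy hx) hx) hy), hκ _ (mul_mem hx hy) _ (mul_mem hx hy),
      hκ _ (mul_mem (mul_mem hx hy) hx) _ hy, one_mul, hrot1, two_mul, add_smul, add_assoc]
    simp [word, mul_assoc]
  have e2 : c (der x (z * X K y)) = (2 * κ) • cyc K n (word K [x, x, y, y]) +
      κ • cyc K n (word K [x, y, x, y]) := by
    have hsum : (der x (X K l * X K y)).1 z =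
        1 * X K l * (X K y * X K y * X K x * X K x) +
          X K x * X K y * X K l * (X K y * X K x) +
          X K x * X K y * X K x * X K l * X K y := by
      simp only [z, der_map_mul, der_X_self, der_X_of_ne hxy.symm]
      noncomm_ring
    rw [cocycle_der_mul hc hdeg hxl hz hy hyx, hsum,
      ← derLin_apply, map_add, map_add, map_add, map_add]
    change c (insDer l _ _) + c (insDer l _ _) + c (insDer l _ _) = _
    rw [hκ _ h1l _ (mul_mem (mul_mem (mul_mem hy hy) hx) hx), hκ _ (mul_mem hx hy) _ (mul_mem hy hx),
      hκ _ (mul_mem (mul_mem hx hy) hx) _ hy, one_mul, hrot2, hrot3, two_mul, add_smul]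
    simp [word, mul_assoc]
  have h := congrArg (rotCoeff K [x, x, y, y]) (e1.symm.trans e2)
  have hrot : ¬ [x, y, x, y] ~r [x, x, y, y] := by
    intro h
    obtain ⟨i, hi, h⟩ := List.isRotated_iff_mod.1 h
    have hi' : i ≤ 4 := hi
    interval_cases i <;> simp [hxy, hxy.symm] at h
  simp only [map_add, map_smul, rotCoeff_cyc, rotForm_word, hrot, List.IsRotated.refl, if_true,
    if_false, smul_eq_mul] at h
  linear_combination -h

theorem cocycle_eq_zero_of_weight_zero [CharZero K] (hc : IsOneCocycle c) (hdeg : IsDegreeZero c)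
    {l x y : Fin n} (hxl : x ≠ l) (hyl : y ≠ l) (hxy : x ≠ y) {v : Der K n}
    (hv : ⁅euler K l, v⁆ = 0) : c v = 0 := by
  have hins : ∀ α ∈ avoid K l, ∀ β ∈ avoid K l, c (insDer l α β) = 0 := fun α hα β hβ =>
    cocycle_insDer hc hdeg hxl hyl hxy hα hβ
  have hw : ∀ i, (euler K l).1 (v.1 (X K i)) = v.1 ((euler K l).1 (X K i)) := fun i => by
    rw [← sub_eq_zero, ← lie_apply, hv]
    rfl
  rw [der_eq_sum v, map_sum]
  refine Finset.sum_eq_zero fun i _ => ?_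
  rcases eq_or_ne i l with rfl | hi
  · have h1 : v.1 (X K i) ∈ LinearMap.ker (c ∘ₗ derLin i) := by
      refine (Submodule.span_le.2 ?_) (mem_span_of_euler_eq (l := i) (k := 1) (a := v.1 (X K i)) ?_)
      · rintro _ ⟨L, hL, rfl⟩
        obtain ⟨s, t, rfl, hs⟩ := List.eq_append_cons_of_mem
          (List.count_pos_iff.1 (by rw [hL]; exact one_pos : 0 < L.count i))
        have ht : i ∉ t := by
          have hL' : (s ++ i :: t).count i = 1 := hL
          rw [List.count_append, List.count_cons_self] at hL'
          exact List.count_eq_zero.1 (by omega)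
        change c (der i (word K (s ++ i :: t))) = 0
        rw [word_append, word_cons, ← mul_assoc]
        exact hins _ (word_mem_avoid hs) _ (word_mem_avoid ht)
      · rw [hw, euler, der_X_self]; simp
    exact h1
  · have h1 : v.1 (X K i) ∈ LinearMap.ker (c ∘ₗ derLin i) := by
      refine (Submodule.span_le.2 ?_) (mem_span_of_euler_eq (l := l) (k := 0) (a := v.1 (X K i)) ?_)
      · rintro _ ⟨L, hL, rfl⟩
        have hz : word K L ∈ avoid K l := word_mem_avoid (List.count_eq_zero.1 hL)
        change c (der i (word K L)) = 0
        rw [← mul_one (word K L), cocycle_der_mul hc hdeg hi hz (one_mem _) (one_mem _), mul_one]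
        -- `∂_i z`, with `x_l` in place of `x_i`, is a sum of elements `α x_l β`
        suffices h : ∀ z ∈ avoid K l, ∀ α ∈ avoid K l, ∀ β ∈ avoid K l,
            c (der l (α * (der i (X K l)).1 z * β)) = 0 by
          simpa using h _ hz 1 (one_mem _) 1 (one_mem _)
        intro z hz
        induction hz using Algebra.adjoin_induction with
        | mem _ h =>
          obtain ⟨j, hj, rfl⟩ := h
          intro α hα β hβ
          rcases eq_or_ne j i with rfl | hji
          · rw [der_X_self]; exact hins α hα β hβ
          · rw [der_X_of_ne hji, mul_zero, zero_mul, ← derLin_apply, map_zero, map_zero]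
        | algebraMap r =>
          intro α _ β _
          rw [der_map_algebraMap, mul_zero, zero_mul, ← derLin_apply, map_zero, map_zero]
        | add _ _ _ _ h1 h2 =>
          intro α hα β hβ
          rw [map_add, mul_add, add_mul, ← derLin_apply, map_add, map_add, derLin_apply,
            derLin_apply, h1 α hα β hβ, h2 α hα β hβ, add_zero]
        | mul a b ha hb h1 h2 =>
          intro α hα β hβ
          rw [der_map_mul, mul_add, add_mul, ← derLin_apply, map_add, map_add, derLin_apply,
            derLin_apply, ← mul_assoc, ← mul_assoc, mul_assoc _ b β,
            h1 α hα _ (mul_mem hb hβ), h2 _ (mul_mem hα ha) β hβ, add_zero]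
      · rw [hw, euler, der_X_of_ne hi]; simp
    exact h1

/-- A degree zero cocycle vanishes as soon as there are three different letters. -/
theorem cocycle_eq_zero [CharZero K] (hc : IsOneCocycle c) (hdeg : IsDegreeZero c)
    {l x y : Fin n} (hxl : x ≠ l) (hyl : y ≠ l) (hxy : x ≠ y) : c = 0 := by
  have hweight := cocycle_eq_zero_of_weight hc hdeg hxl hyl hxy
    fun v => cocycle_eq_zero_of_weight_zero hc hdeg hxl hyl hxy
  ext1 v
  rw [der_eq_sum v, map_sum, LinearMap.zero_apply]
  refine Finset.sum_eq_zero fun i _ => ?_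
  suffices h : c ∘ₗ derLin i = 0 from LinearMap.congr_fun h _
  refine linearMap_ext_word fun L => ?_
  change c (der i (word K L)) = 0
  by_cases hL : l ∈ L
  · have hbr : ⁅euler K l, der i (word K L)⁆ =
        (L.count l : K) • der i (word K L) - der l ((der i (word K L)).1 (X K l)) := by
      rw [euler, lie_der_der, ← euler, euler_word, ← derLin_apply, map_smul, derLin_apply]
    have hpos := List.count_pos_iff.2 hL
    rcases eq_or_ne i l with hi | hi
    · -- here the weight is one less than the number of letters `x_l`
      refine hweight (L.count l - 1) _ ?_
      rw [hbr, hi, der_X_self, Nat.cast_sub hpos, sub_smul, Nat.cast_one, one_smul]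
    · refine hweight (L.count l) _ ?_
      rw [hbr, der_X_of_ne hi.symm, ← derLin_apply, ← derLin_apply, map_zero, sub_zero]
  · have hz := word_mem_avoid (K := K) hL
    rcases eq_or_ne i l with hi | hi
    · rw [hi]
      exact cocycle_der_avoid hc hdeg hz
    · exact cocycle_eq_zero_of_weight_zero hc hdeg hxl hyl hxy (lie_euler_der_of_ne hi hz)

end Cocycle

end CyclicWords

theorem mainTheorem2 (K : Type*) [Field K] [CharZero K] (n : ℕ) (hn : 3 ≤ n)
    (c : CyclicWords.Der K n →ₗ[K] CyclicWords.Cyc K n)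
    (hcocycle : CyclicWords.IsOneCocycle c) (hdeg : CyclicWords.IsDegreeZero c) :
    c = 0 :=
  CyclicWords.cocycle_eq_zero hcocycle hdeg (l := ⟨0, by omega⟩) (x := ⟨1, by omega⟩)
    (y := ⟨2, by omega⟩) (by simp) (by simp) (by simp)
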